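/- A skew brace $(A,\cdot,\circ)$ is a set $A$ with two group operations $\cdot$ (the additive group) and $\circ$ (the multiplicative group) such that $a\circ(b\cdot c)=(a\circ b)\cdot a^{-1}\cdot(a\circ c)$ for all $a,b,c\in A$, where $a^{-1}$ is the inverse of $a$ in $(A,\cdot)$. It is a brace if $(A,\cdot)$ is abelian, it is trivial if $a\cdot b=a\circ b$ for all $a,b\in A$, and it is a bi-skew brace if $(A,\circ,\cdot)$ is a skew brace as well. Put $a*b=a^{-1}\cdot(a\circ b)\cdot b^{-1}$, let $A^{(1)}=A$, and for $m\ge 1$ let $A^{(m+1)}$ be the subgroup of $(A,\cdot)$ generated by all $a*b$ with $a\in A^{(m)}$ and $b\in A$. The skew brace $A$ is right nilpotent if $A^{(m+1)}=\{1\}$ for some $m\ge 0$, and the least such $m$ is its right nilpotency class. Let $n\ge 0$ and let $A$ be a brace whose multiplicative group is isomorphic to $\mathbb{Z}^n$. Then $A$ is right nilpotent of right nilpotency class at most $n$. Moreover, if $n=1$, then $A$ is a trivial brace, and if $n=2$, then $A$ is a bi-skew brace. -/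

import Mathlib

/-- A skew (left) brace `(A, ·, ∘)`. The additive group `(A, ·)` is written with `+`
(it need not be commutative), the multiplicative group `(A, ∘)` is written with `*`.
The left brace equation `a ∘ (b · c) = (a ∘ b) · a⁻¹ · (a ∘ c)` then reads as below. A brace is
a skew brace with abelian additive group, that is, `[AddCommGroup A] [Group A] [SkewBrace A]`. -/
class SkewBrace (A : Type*) [AddGroup A] [Group A] : Prop where
  left_brace : ∀ a b c : A, a * (b + c) = a * b + -a + a * c

namespace SkewBrace

/-- A skew brace `(A, ·, ∘)` is a bi-skew brace if `(A, ∘, ·)` is a skew brace as well, that is,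
the left brace equation also holds with the roles of the two groups exchanged. -/
structure IsBiSkew (A : Type*) [AddGroup A] [Group A] : Prop extends SkewBrace A where
  left_brace_swap : ∀ a b c : A, a + b * c = (a + b) * a⁻¹ * (a + c)

/-- A skew brace is trivial if its two operations coincide. -/
def IsTrivial (A : Type*) [AddGroup A] [Group A] : Prop :=
  ∀ a b : A, a + b = a * b

/-- The map `γ(a) : b ↦ a⁻¹ · (a ∘ b)` (the inverse is taken in the additive group). -/
def gamma {A : Type*} [AddGroup A] [Group A] (a b : A) : A :=
  -a + a * b

/-- The third operation of a skew brace, sending `a`, `b` to `γ(a)(b) · b⁻¹`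
(the inverse is taken in the additive group). -/
def starOp {A : Type*} [AddGroup A] [Group A] (a b : A) : A :=
  gamma a b + -b

/-- For subsets `X`, `Y`, the subgroup of the additive group that is generated by all
`starOp x y` with `x ∈ X` and `y ∈ Y`. -/
def starSubgroup {A : Type*} [AddGroup A] [Group A] (X Y : Set A) : AddSubgroup A :=
  AddSubgroup.closure {z | ∃ x ∈ X, ∃ y ∈ Y, starOp x y = z}

/-- The right series of a skew brace, with indices shifted by one: `rightSeries A n` is `A⁽ⁿ⁺¹⁾`,
where `A⁽¹⁾ = A`, and `A⁽ⁿ⁺¹⁾` is the star product of `A⁽ⁿ⁾` and `A`. -/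
def rightSeries (A : Type*) [AddGroup A] [Group A] : ℕ → AddSubgroup A
  | 0 => ⊤
  | n + 1 => starSubgroup (rightSeries A n : Set A) Set.univ

/-- A skew brace is right nilpotent if `A⁽ⁿ⁺¹⁾` is trivial for some `n ≥ 0`. -/
def IsRightNilpotent (A : Type*) [AddGroup A] [Group A] : Prop :=
  ∃ n : ℕ, rightSeries A n = ⊥

/-- The right nilpotency class: the least `n ≥ 0` such that `A⁽ⁿ⁺¹⁾` is trivial
(meaningful only for right nilpotent skew braces). -/
noncomputable def rightNilpotencyClass (A : Type*) [AddGroup A] [Group A] : ℕ :=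
  sInf {n : ℕ | rightSeries A n = ⊥}

end SkewBrace

/-!
A brace whose multiplicative group is commutative is the same thing as a commutative (Jacobson)
radical ring: the star operation `a * b - a - b` is associative and biadditive, and the
multiplicative group is its adjoint group. The terms of the right series are the powers of this
ring, so the claim is that a commutative radical ring `R` whose adjoint group is free abelian of
rank `n` satisfies `R ^ (n + 1) = 0`.

*Nilpotency.* The unitization `S = ℤ ⊕ R` is a quotient of the group ring over `ℤ` of the adjoint
group, hence of finite type over `ℤ` as soon as that group is finitely generated
(`finiteType_unitization`). So `S` is a Noetherian Jacobson ring. As `1 + R` consists of units, `R`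
lies in the Jacobson radical of `S`, which is the nilradical and therefore nilpotent
(`exists_rightSeries_eq_bot`).

*The class.* On a quotient of consecutive terms of the right series the two group operations
coincide, so that `a ^ m` and `m • a` agree there. If all elements of one such quotient were
torsion, then multiplication would make all elements of the later quotients torsion as well; by
nilpotency the whole term would then be additively torsion. But a nilpotent ring whose adjoint
group is torsion-free has no additive torsion (`eq_zero_of_nsmul_eq_zero`). Hence the rank of the
terms, as subgroups of the multiplicative group, drops strictly until the series vanishes
(`finrank_rightSeries_lt`), which takes at most `n` steps.

For `n = 1` this says that the star operation vanishes, and for `n = 2` that it vanishes on triples,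
which gives the exchanged brace equation by a direct computation.
-/

namespace SkewBrace

section CommutativeMultiplication

variable {A : Type*} [AddCommGroup A] [CommGroup A]

/-! ### The star operation and the right series -/

lemma mul_eq_add_starOp (a b : A) : a * b = a + b + starOp a b := by
  simp only [starOp, gamma]; abel

lemma starOp_comm (a b : A) : starOp a b = starOp b a := by
  simp only [starOp, gamma, mul_comm a b]; abel

lemma starOp_mem_rightSeries_succ {k : ℕ} {a : A} (ha : a ∈ rightSeries A k) (b : A) :
    starOp a b ∈ rightSeries A (k + 1) :=
  AddSubgroup.subset_closure ⟨a, ha, b, Set.mem_univ b, rfl⟩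

variable (A) in
lemma rightSeries_succ_le (k : ℕ) : rightSeries A (k + 1) ≤ rightSeries A k := by
  induction k with
  | zero => exact le_top
  | succ k ih =>
    refine (AddSubgroup.closure_le _).2 ?_
    rintro _ ⟨x, hx, y, -, rfl⟩
    exact starOp_mem_rightSeries_succ (ih hx) y

lemma mul_mem_rightSeries {k : ℕ} {a b : A} (ha : a ∈ rightSeries A k)
    (hb : b ∈ rightSeries A k) : a * b ∈ rightSeries A k := by
  rw [mul_eq_add_starOp]
  exact add_mem (add_mem ha hb) (rightSeries_succ_le A k (starOp_mem_rightSeries_succ ha b))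

/-! ### An embedding criterion for right nilpotency -/

instance isJacobsonRing_int : IsJacobsonRing ℤ := by
  refine isJacobsonRing_iff_prime_eq.2 fun P hP ↦ ?_
  by_cases hbot : P = ⊥
  · subst hbot
    refine le_antisymm (fun x hx ↦ ?_) Ideal.le_jacobson
    -- `x * (3 * x) + 1 = ± 1` forces `x = 0`
    have h := Ideal.mem_jacobson_bot.1 hx (3 * x)
    rcases Int.isUnit_iff.1 h with h | h
    · have : x * x = 0 := by linarith
      simpa using this
    · nlinarith [mul_self_nonneg x]
  · have := hP.isMaximal hbot
    exact Ideal.jacobson_eq_self_of_isMaximal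

lemma map_mem_pow_of_mem_rightSeries {S : Type*} [CommRing S] {φ : A →+ S}
    (hφ : ∀ a b, φ (starOp a b) = φ a * φ b) {I : Ideal S} (hI : ∀ a, φ a ∈ I) (k : ℕ) {a : A}
    (ha : a ∈ rightSeries A k) : φ a ∈ I ^ k := by
  induction k generalizing a with
  | zero => simp
  | succ k ih =>
    refine AddSubgroup.closure_induction ?_ ?_ ?_ ?_ ha
    · rintro _ ⟨x, hx, y, -, rfl⟩
      rw [hφ, pow_succ]
      exact Ideal.mul_mem_mul (ih hx) (hI y)
    · simp
    · intro x y _ _ hx hy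
      simpa using add_mem hx hy
    · intro x _ hx
      simpa using hx

/-- If `A`, with the star operation as multiplication, embeds into the Jacobson radical of a ring
of finite type over `ℤ`, then the right series reaches zero. -/
lemma exists_rightSeries_eq_bot_of_embedding {S : Type*} [CommRing S] [Algebra ℤ S]
    [Algebra.FiniteType ℤ S] {φ : A →+ S} (hinj : Function.Injective φ)
    (hφ : ∀ a b, φ (starOp a b) = φ a * φ b) (hunit : ∀ a s, IsUnit (φ a * s + 1)) :
    ∃ k, rightSeries A k = ⊥ := by
  have := Algebra.FiniteType.isNoetherianRing ℤ S
  have : IsJacobsonRing S := by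
    obtain ⟨n, f, hf⟩ := (Algebra.FiniteType.iff_quotient_mvPolynomial'' (R := ℤ) (S := S)).1 ‹_›
    exact isJacobsonRing_of_surjective ⟨(f : MvPolynomial (Fin n) ℤ →+* S), hf⟩
  obtain ⟨k, hk⟩ := IsNoetherianRing.isNilpotent_nilradical S
  refine ⟨k, (AddSubgroup.eq_bot_iff_forall _).2 fun a ha ↦ ?_⟩
  have h := map_mem_pow_of_mem_rightSeries hφ (I := nilradical S) (fun b ↦ ?_) k ha
  · rw [hk] at h
    exact hinj (by simpa using h)
  · rw [nilradical, Ideal.radical_eq_jacobson]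
    exact Ideal.mem_jacobson_bot.2 (hunit b)

/-! ### The radical ring of a brace with commutative multiplicative group -/

variable [SkewBrace A]

lemma starOp_add (a b c : A) : starOp a (b + c) = starOp a b + starOp a c := by
  simp only [starOp, gamma, left_brace]; abel

lemma add_starOp (a b c : A) : starOp (a + b) c = starOp a c + starOp b c := by
  rw [starOp_comm, starOp_add, starOp_comm c a, starOp_comm c b]

lemma starOp_assoc (a b c : A) : starOp (starOp a b) c = starOp a (starOp b c) := by
  -- both bracketings of the triple product of `a`, `b`, `c` expand to sums that differ only here
  have h := mul_assoc a b c
  rw [mul_eq_add_starOp (a * b), mul_eq_add_starOp a b, mul_eq_add_starOp a (b * c),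
    mul_eq_add_starOp b c] at h
  simp only [add_starOp, starOp_add] at h
  rw [← sub_eq_zero] at h ⊢
  rw [← h]; abel

variable (A) in
lemma zero_eq_one : (0 : A) = 1 := by
  have h : (1 : A) * (0 + 0) = 1 * 0 + -1 + 1 * 0 := left_brace 1 0 0
  simpa [eq_comm, neg_eq_zero] using h

lemma starOp_zero (a : A) : starOp a 0 = 0 := by
  simpa using starOp_add a 0 0

lemma zero_starOp (a : A) : starOp 0 a = 0 := by
  rw [starOp_comm, starOp_zero]

variable (A) in
/-- The additive group of a brace with commutative multiplicative group, as the carrier of a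
commutative non-unital ring with multiplication `starOp`. -/
def RadicalRing : Type _ := A

instance : AddCommGroup (RadicalRing A) := inferInstanceAs (AddCommGroup A)

instance : NonUnitalCommRing (RadicalRing A) where
  mul a b := starOp (A := A) a b
  left_distrib := starOp_add (A := A)
  right_distrib := add_starOp (A := A)
  zero_mul := zero_starOp (A := A)
  mul_zero := starOp_zero (A := A)
  mul_assoc := starOp_assoc (A := A)
  mul_comm := starOp_comm (A := A)

variable (A) in
/-- The inclusion of a brace with commutative multiplicative group, as an ideal, into the
unitization of its radical ring. -/
def toUnitization : A →+ Unitization ℤ (RadicalRing A) where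
  toFun a := Unitization.inr (R := ℤ) (A := RadicalRing A) a
  map_zero' := Unitization.inr_zero ℤ
  map_add' a b := Unitization.inr_add ℤ (A := RadicalRing A) a b

lemma toUnitization_starOp (a b : A) :
    toUnitization A (starOp a b) = toUnitization A a * toUnitization A b :=
  Unitization.inr_mul ℤ (A := RadicalRing A) a b

lemma toUnitization_injective : Function.Injective (toUnitization A) :=
  Unitization.inr_injective (R := ℤ) (A := RadicalRing A)

variable (A) in
/-- The embedding `a ↦ 1 + a` of the multiplicative group into the multiplicative monoid of the
unitization of the radical ring. -/
def oneAddHom : A →* Unitization ℤ (RadicalRing A) where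
  toFun a := 1 + toUnitization A a
  map_one' := by rw [← zero_eq_one, map_zero, add_zero]
  map_mul' a b := by
    rw [mul_eq_add_starOp, map_add, map_add, toUnitization_starOp]; ring

lemma oneAddHom_apply (a : A) : oneAddHom A a = 1 + toUnitization A a := rfl

/-! ### Nilpotency -/

variable (A) in
/-- The unitization is a quotient of the group ring of the multiplicative group. -/
lemma finiteType_unitization [Group.FG A] :
    Algebra.FiniteType ℤ (Unitization ℤ (RadicalRing A)) := by
  have : Monoid.FG A := Group.fg_iff_monoid_fg.1 inferInstance
  refine Algebra.FiniteType.of_surjective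
    (MonoidAlgebra.lift ℤ (Unitization ℤ (RadicalRing A)) A (oneAddHom A)) fun s ↦ ?_
  obtain ⟨a, ha⟩ : ∃ a, toUnitization A a = Unitization.inr s.snd := ⟨s.snd, rfl⟩
  refine ⟨algebraMap ℤ _ (s.fst - 1) + MonoidAlgebra.of ℤ A a, ?_⟩
  rw [map_add, AlgHom.commutes, MonoidAlgebra.lift_of, oneAddHom_apply, map_sub, map_one, ha,
    Unitization.algebraMap_eq_inl]
  conv_rhs => rw [← Unitization.inl_fst_add_inr_snd_eq s]
  ring

/-- In the unitization, `A` lies in the Jacobson radical. -/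
lemma isUnit_toUnitization_mul_add_one (a : A) (s : Unitization ℤ (RadicalRing A)) :
    IsUnit (toUnitization A a * s + 1) := by
  -- the product lies in the ideal `A`, and `1 + A` consists of units
  obtain ⟨b, hb⟩ : ∃ b, toUnitization A b = toUnitization A a * s := by
    refine ⟨(toUnitization A a * s).snd, Unitization.ext ?_ rfl⟩
    change 0 = (toUnitization A a * s).fst
    rw [Unitization.fst_mul]
    exact (zero_mul _).symm
  rw [← hb, add_comm, ← oneAddHom_apply]
  exact (Group.isUnit b).map (oneAddHom A)

variable (A) in
lemma exists_rightSeries_eq_bot [Group.FG A] : ∃ k, rightSeries A k = ⊥ :=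
  have := finiteType_unitization A
  exists_rightSeries_eq_bot_of_embedding (S := Unitization ℤ (RadicalRing A))
    toUnitization_injective toUnitization_starOp isUnit_toUnitization_mul_add_one

/-! ### Powers and multiples along the right series -/

lemma inv_mem_rightSeries {k : ℕ} {a : A} (ha : a ∈ rightSeries A k) :
    a⁻¹ ∈ rightSeries A k := by
  have h : a⁻¹ = -a - starOp a a⁻¹ := by
    have h := mul_eq_add_starOp a a⁻¹
    rw [mul_inv_cancel, ← zero_eq_one] at h
    rw [← sub_eq_zero, h]; abel
  rw [h]
  exact sub_mem (neg_mem ha) (rightSeries_succ_le A k (starOp_mem_rightSeries_succ ha _))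

/-- Modulo the next term of the right series, powers and multiples coincide. -/
lemma pow_sub_nsmul_mem {k : ℕ} {a : A} (ha : a ∈ rightSeries A k) (m : ℕ) :
    a ^ m - m • a ∈ rightSeries A (k + 1) := by
  induction m with
  | zero => simp [← zero_eq_one A]
  | succ m ih =>
    have h : a ^ (m + 1) - (m + 1) • a = (a ^ m - m • a) + starOp a (a ^ m) := by
      rw [pow_succ, mul_eq_add_starOp, succ_nsmul, starOp_comm a]; abel
    rw [h]
    exact add_mem ih (starOp_mem_rightSeries_succ ha _)

lemma nsmul_starOp (m : ℕ) (a b : A) : m • starOp a b = starOp (m • a) b := by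
  induction m with
  | zero => simp [zero_starOp]
  | succ m ih => rw [succ_nsmul, succ_nsmul, add_starOp, ih]

lemma nsmul_pow_eq_zero {m : ℕ} {a : A} (ha : m • a = 0) (j : ℕ) : m • a ^ j = 0 := by
  induction j with
  | zero => rw [pow_zero, ← zero_eq_one, smul_zero]
  | succ j ih =>
    rw [pow_succ, mul_eq_add_starOp, smul_add, smul_add, nsmul_starOp, ih, ha, zero_starOp]
    simp

/-- A nilpotent brace with torsion-free commutative multiplicative group has torsion-free
additive group: if `m • a = 0`, then passing from `a` to `a ^ m` moves down the right series. -/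
lemma eq_zero_of_nsmul_eq_zero [IsMulTorsionFree A] (hA : ∃ k, rightSeries A k = ⊥) {m : ℕ}
    (hm : m ≠ 0) {a : A} (ha : m • a = 0) : a = 0 := by
  obtain ⟨l, hl⟩ := hA
  suffices H : ∀ k ≤ l, ∀ a ∈ rightSeries A k, m • a = 0 → a = 0 from
    H 0 l.zero_le a (AddSubgroup.mem_top a) ha
  intro k hk
  induction hk using Nat.decreasingInduction with
  | self => intro a ha _; simpa [hl] using ha
  | of_succ k _ ih =>
    intro a hak ha
    have h := ih (a ^ m) (by simpa [ha] using pow_sub_nsmul_mem hak m) (nsmul_pow_eq_zero ha m)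
    rw [zero_eq_one] at h ⊢
    exact (pow_eq_one_iff_left hm).1 h

/-- Torsion of one factor of the right series is inherited by the next one. -/
lemma exists_nsmul_mem_succ {k : ℕ}
    (h : ∀ a ∈ rightSeries A k, ∃ m : ℕ, m ≠ 0 ∧ m • a ∈ rightSeries A (k + 1)) :
    ∀ a ∈ rightSeries A (k + 1), ∃ m : ℕ, m ≠ 0 ∧ m • a ∈ rightSeries A (k + 2) := by
  intro a ha
  refine AddSubgroup.closure_induction ?_ ?_ ?_ ?_ ha
  · rintro _ ⟨x, hx, y, -, rfl⟩
    obtain ⟨m, hm, hmx⟩ := h x hx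
    exact ⟨m, hm, by rw [nsmul_starOp]; exact starOp_mem_rightSeries_succ hmx y⟩
  · exact ⟨1, one_ne_zero, by simp⟩
  · rintro x y _ _ ⟨m, hm, hx⟩ ⟨m', hm', hy⟩
    refine ⟨m * m', mul_ne_zero hm hm', ?_⟩
    rw [smul_add]
    refine add_mem ?_ ?_
    · rw [mul_comm, mul_smul]; exact nsmul_mem hx m'
    · rw [mul_smul]; exact nsmul_mem hy m
  · rintro x _ ⟨m, hm, hx⟩
    exact ⟨m, hm, by simpa using hx⟩

lemma rightSeries_eq_bot_of_torsion [IsMulTorsionFree A] (hA : ∃ k, rightSeries A k = ⊥) {k : ℕ}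
    (h : ∀ a ∈ rightSeries A k, ∃ m : ℕ, m ≠ 0 ∧ m • a ∈ rightSeries A (k + 1)) :
    rightSeries A k = ⊥ := by
  have hstep : ∀ j, ∀ a ∈ rightSeries A (k + j), ∃ m : ℕ, m ≠ 0 ∧
      m • a ∈ rightSeries A (k + j + 1) := by
    intro j
    induction j with
    | zero => exact h
    | succ j ih => exact exists_nsmul_mem_succ ih
  have hiter : ∀ j, ∀ a ∈ rightSeries A k, ∃ m : ℕ, m ≠ 0 ∧ m • a ∈ rightSeries A (k + j) := by
    intro j a ha
    induction j with
    | zero => exact ⟨1, one_ne_zero, by simpa using ha⟩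
    | succ j ih =>
      obtain ⟨m, hm, hma⟩ := ih
      obtain ⟨m', hm', hma'⟩ := hstep j _ hma
      exact ⟨m' * m, mul_ne_zero hm' hm, by rw [mul_smul]; exact hma'⟩
  refine (AddSubgroup.eq_bot_iff_forall _).2 fun a ha ↦ ?_
  obtain ⟨l, hl⟩ := hA
  obtain ⟨m, hm, hma⟩ := hiter l a ha
  have hle : rightSeries A (k + l) ≤ rightSeries A l :=
    antitone_nat_of_succ_le (rightSeries_succ_le A) (Nat.le_add_left l k)
  refine eq_zero_of_nsmul_eq_zero ⟨l, hl⟩ hm ?_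
  simpa [hl] using hle hma

/-! ### Ranks of the terms of the right series -/

variable (A) in
/-- A term of the right series as a subgroup of the multiplicative group, the latter being written
additively in order to speak of its rank over `ℤ`. -/
def rightSeriesMul (k : ℕ) : Submodule ℤ (Additive A) :=
  AddSubgroup.toIntSubmodule
    { carrier := {x | x.toMul ∈ rightSeries A k}
      zero_mem' := by
        change (1 : A) ∈ rightSeries A k
        rw [← zero_eq_one]; exact zero_mem _
      add_mem' := fun hx hy ↦ mul_mem_rightSeries hx hy
      neg_mem' := fun hx ↦ inv_mem_rightSeries hx }

lemma mem_rightSeriesMul {k : ℕ} {x : Additive A} :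
    x ∈ rightSeriesMul A k ↔ x.toMul ∈ rightSeries A k := Iff.rfl

lemma rightSeriesMul_succ_le (k : ℕ) : rightSeriesMul A (k + 1) ≤ rightSeriesMul A k :=
  fun _ hx ↦ rightSeries_succ_le A k hx

end CommutativeMultiplication

/-- A submodule of full rank has torsion quotient. -/
lemma exists_nsmul_mem_of_finrank_le {M : Type*} [AddCommGroup M] [Module.Finite ℤ M]
    {P Q : Submodule ℤ M} (hPQ : P ≤ Q) (h : Module.finrank ℤ Q ≤ Module.finrank ℤ P) {x : M}
    (hx : x ∈ Q) : ∃ m : ℕ, m ≠ 0 ∧ m • x ∈ P := by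
  have h1 := Submodule.finrank_quotient_add_finrank (P.submoduleOf Q)
  rw [(Submodule.submoduleOfEquivOfLe hPQ).finrank_eq] at h1
  obtain ⟨c, hc, hcx⟩ := Module.finrank_eq_zero_iff.1
    (show Module.finrank ℤ (Q ⧸ P.submoduleOf Q) = 0 by omega)
    (Submodule.Quotient.mk (⟨x, hx⟩ : Q))
  rw [← Submodule.Quotient.mk_smul, Submodule.Quotient.mk_eq_zero] at hcx
  have hcx' : c • x ∈ P := hcx
  refine ⟨c.natAbs, Int.natAbs_ne_zero.2 hc, ?_⟩
  rw [← natCast_zsmul]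
  rcases Int.natAbs_eq c with h | h
  · rwa [← h]
  · rw [show ((c.natAbs : ℕ) : ℤ) = -c by omega, neg_smul]
    exact neg_mem hcx'

section CommutativeMultiplication

variable {A : Type*} [AddCommGroup A] [CommGroup A] [SkewBrace A]

lemma finrank_rightSeries_lt [IsMulTorsionFree A] [Module.Finite ℤ (Additive A)]
    (hA : ∃ k, rightSeries A k = ⊥) {k : ℕ} (hk : rightSeries A k ≠ ⊥) :
    Module.finrank ℤ (rightSeriesMul A (k + 1)) < Module.finrank ℤ (rightSeriesMul A k) := by
  by_contra! hle
  refine hk (rightSeries_eq_bot_of_torsion hA fun a ha ↦ ?_)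
  obtain ⟨m, hm, hma⟩ := exists_nsmul_mem_of_finrank_le (rightSeriesMul_succ_le k) hle
    (x := Additive.ofMul a) ha
  refine ⟨m, hm, ?_⟩
  have hpow : a ^ m ∈ rightSeries A (k + 1) := hma
  simpa using sub_mem hpow (pow_sub_nsmul_mem ha m)

lemma rightSeries_finrank_eq_bot [IsMulTorsionFree A] [Module.Finite ℤ (Additive A)]
    (hA : ∃ k, rightSeries A k = ⊥) :
    rightSeries A (Module.finrank ℤ (Additive A)) = ⊥ := by
  have key : ∀ k, rightSeries A k ≠ ⊥ →
      Module.finrank ℤ (rightSeriesMul A k) + k ≤ Module.finrank ℤ (Additive A) := by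
    intro k
    induction k with
    | zero => intro _; exact Submodule.finrank_le _
    | succ k ih =>
      intro h
      have hk : rightSeries A k ≠ ⊥ := fun hk ↦ h (le_bot_iff.1 (hk ▸ rightSeries_succ_le A k))
      have := ih hk
      have := finrank_rightSeries_lt hA hk
      omega
  by_contra h
  -- the term would have rank zero, which leaves no room for the next strict drop
  have := key _ h
  have := finrank_rightSeries_lt hA h
  omega

end CommutativeMultiplication

/-! ### Small class -/

section SmallClass

variable {A : Type*} [AddCommGroup A] [CommGroup A]

lemma isTrivial_of_rightSeries_one (h : rightSeries A 1 = ⊥) : IsTrivial A := by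
  intro a b
  have hs := starOp_mem_rightSeries_succ (k := 0) (AddSubgroup.mem_top a) b
  rw [zero_add, h, AddSubgroup.mem_bot] at hs
  rw [mul_eq_add_starOp, hs, add_zero]

variable [SkewBrace A] in
lemma isBiSkew_of_rightSeries_two (h : rightSeries A 2 = ⊥) : IsBiSkew A where
  left_brace_swap a b c := by
    have h3 (x y z : A) : starOp (starOp x y) z = 0 := by
      have hs := starOp_mem_rightSeries_succ
        (starOp_mem_rightSeries_succ (k := 0) (AddSubgroup.mem_top x) y) z
      rwa [zero_add, one_add_one_eq_two, h, AddSubgroup.mem_bot] at hs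
    -- with the inverse of `a` cleared, both sides expand to sums without triple products
    rw [mul_right_comm, eq_mul_inv_iff_mul_eq]
    simp only [mul_eq_add_starOp, add_starOp, starOp_add, h3]
    rw [starOp_comm b a, starOp_comm c a]
    abel

end SmallClass

end SkewBrace

theorem mainTheorem3 (A : Type*) [AddCommGroup A] [Group A] [SkewBrace A] (n : ℕ)
    (hA : Nonempty (A ≃* Multiplicative (Fin n → ℤ))) :
    (SkewBrace.IsRightNilpotent A ∧ SkewBrace.rightNilpotencyClass A ≤ n) ∧
    (n = 1 → SkewBrace.IsTrivial A) ∧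
    (n = 2 → SkewBrace.IsBiSkew A) := by
  obtain ⟨e⟩ := hA
  let _ : CommGroup A :=
    { ‹Group A› with mul_comm := fun a b ↦ e.injective (by rw [map_mul, map_mul, mul_comm]) }
  let f : (Fin n → ℤ) ≃ₗ[ℤ] Additive A := (MulEquiv.toAdditiveLeft e).symm.toIntLinearEquiv
  have : Module.Finite ℤ (Additive A) := Module.Finite.equiv f
  have hrank : Module.finrank ℤ (Additive A) = n := by
    rw [← f.finrank_eq, Module.finrank_fin_fun]
  have : IsMulTorsionFree A := Function.Injective.isMulTorsionFree e.toMonoidHom e.injective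
  have : Group.FG A :=
    GroupFG.iff_add_fg.2 (Module.Finite.iff_addGroup_fg.1 inferInstance)
  have hbot : SkewBrace.rightSeries A n = ⊥ :=
    hrank ▸ SkewBrace.rightSeries_finrank_eq_bot (SkewBrace.exists_rightSeries_eq_bot A)
  refine ⟨⟨⟨n, hbot⟩, Nat.sInf_le hbot⟩, ?_, ?_⟩
  · rintro rfl
    exact SkewBrace.isTrivial_of_rightSeries_one hbot
  · rintro rfl
    exact SkewBrace.isBiSkew_of_rightSeries_two hbot
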